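/- Let $\mathbb T\subset\mathbb R$ be a nonempty, closed, bounded set (a bounded time scale), $a=\inf\mathbb T$, $b=\sup\mathbb T$. For $t\in\mathbb T$ let $\sigma(t)=\inf\{s\in\mathbb T:s>t\}$ if $t\ne b$, $\sigma(b)=b$, and $\rho(t)=\sup\{s\in\mathbb T:s<t\}$ if $t\ne a$, $\rho(a)=a$. For a time scale $S$, let $S^{k}=S\setminus\{\max S\}$ if $S$ has a maximum and it is left-scattered (i.e. the backward jump of $\max S$ in $S$ is less than $\max S$), and $S^k=S$ otherwise; put $\mathbb T^{k^2}=(\mathbb T^k)^k$. A function $f$ on $S$ is delta differentiable at $t\in S^k$ with derivative $f^\Delta(t)$ if for every $\varepsilon>0$ there is $\delta>0$ such that $|f(\sigma(t))-f(s)-f^\Delta(t)(\sigma(t)-s)|\le\varepsilon|\sigma(t)-s|$ for all $s\in S\cap(t-\delta,t+\delta)$, where $\sigma$ is the forward jump of $S$. Write $\int_c^d f\,\Delta t=F(d)-F(c)$, where $F^\Delta=f$ on $\mathbb T^k$; and let $y^{\Delta\Delta}$ be the delta derivative, on the time scale $\mathbb T^k$, of $y^\Delta:\mathbb T^k\to\mathbb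 R$. Assume $a\neq\rho(b)$ and let $q:\mathbb T\to\mathbb R$ be continuous. An eigenvalue of the problem $$-y^{\Delta\Delta}(t)+q(t)\,y(\sigma(t))=\lambda\,y(\sigma(t)),\quad t\in\mathbb T^{k^2},\qquad y^\Delta(a)=y^\Delta(\rho(b))=0,$$ is a number $\lambda\in\mathbb R$ for which it has a solution $y:\mathbb T\to\mathbb R$ that is not identically zero. If the first (smallest) eigenvalue $\lambda_1$ satisfies $$\lambda_1=\frac1{\rho(b)-a}\int_a^{\rho(b)}q(t)\,\Delta t,$$ then $q(t)=\lambda_1$ for all $t\in\mathbb T^{k^2}$. -/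

import Mathlib

/-! Basic calculus on a time scale `T`, a closed subset of `ℝ`.  Functions on `T` are written as
functions `ℝ → ℝ`, of which only the values on `T` are ever used. -/

namespace TimeScale

/-- The forward jump operator: `σ t = inf {s ∈ T : s > t}`, and `σ (sup T) = sup T`. -/
noncomputable def sigma (T : Set ℝ) (t : ℝ) : ℝ :=
  open Classical in if ∃ s ∈ T, t < s then sInf {s | s ∈ T ∧ t < s} else t

/-- The backward jump operator: `ρ t = sup {s ∈ T : s < t}`, and `ρ (inf T) = inf T`. -/
noncomputable def rho (T : Set ℝ) (t : ℝ) : ℝ :=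
  open Classical in if ∃ s ∈ T, s < t then sSup {s | s ∈ T ∧ s < t} else t

/-- `T^k`: the set `T` without its maximum if that maximum exists and is left-scattered,
and `T` itself otherwise. -/
def kappa (T : Set ℝ) : Set ℝ :=
  {t | t ∈ T ∧ ¬ (IsGreatest T t ∧ rho T t < t)}

/-- `f` is delta differentiable at `t` on the time scale `T`, with delta derivative `d`. -/
def HasDeltaDerivAt (T : Set ℝ) (f : ℝ → ℝ) (d t : ℝ) : Prop :=
  ∀ ε : ℝ, 0 < ε → ∃ δ : ℝ, 0 < δ ∧ ∀ s ∈ T, s ∈ Set.Ioo (t - δ) (t + δ) →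
    |(f (sigma T t) - f s) - d * (sigma T t - s)| ≤ ε * |sigma T t - s|

/-- `F` is an antiderivative of `f` on `T`: `F^Δ = f` on `T^k`. -/
def IsAntiderivative (T : Set ℝ) (F f : ℝ → ℝ) : Prop :=
  ∀ t ∈ kappa T, HasDeltaDerivAt T F (f t) t

/-- The Cauchy delta integral `∫_c^d f(t) Δt = F d - F c`, where `F` is an antiderivative of `f`
on `T` (and `0` if `f` has no antiderivative). -/
noncomputable def deltaIntegral (T : Set ℝ) (f : ℝ → ℝ) (c d : ℝ) : ℝ :=
  open Classical in
  if h : ∃ F : ℝ → ℝ, IsAntiderivative T F f then h.choose d - h.choose c else 0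

/-- `l` is an eigenvalue of `-y^ΔΔ(t) + q(t) y(σ t) = l y(σ t)`, `t ∈ T^{k²}`, with
`y^Δ(a) = y^Δ(ρ b) = 0`, where `a = inf T`, `b = sup T`.  Here `y1` is `y^Δ`, a function on `T^k`,
and `y2` is `y^ΔΔ`, the delta derivative of `y^Δ` on the time scale `T^k`. -/
def IsNeumannEigenvalue (T : Set ℝ) (q : ℝ → ℝ) (l : ℝ) : Prop :=
  ∃ y y1 y2 : ℝ → ℝ,
    (∃ t ∈ T, y t ≠ 0) ∧
    (∀ t ∈ kappa T, HasDeltaDerivAt T y (y1 t) t) ∧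
    (∀ t ∈ kappa (kappa T), HasDeltaDerivAt (kappa T) y1 (y2 t) t) ∧
    (∀ t ∈ kappa (kappa T), - y2 t + q t * y (sigma T t) = l * y (sigma T t)) ∧
    y1 (sInf T) = 0 ∧ y1 (rho T (sSup T)) = 0

end TimeScale

namespace TimeScale

open Set Filter Topology MeasureTheory

variable {T : Set ℝ} {t : ℝ}

/-! Write `c = ρ(b)` and, for each `l`, let `y` solve the equation with `y(a) = 1`, `y^Δ(a) = 0`;
put `z = y^Δ`. Whenever `z(c) = 0`, the number `l` is an eigenvalue. For `l` far below the values of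
`q` one has `y ≥ 1` and `z(c) > 0`. Raise `l` to `λ₁`. By the intermediate value theorem `z(c)`
cannot become negative, since this would produce an eigenvalue below `λ₁`. Nor can the minimum of
`y` on `T ∩ [a, c]` reach zero: at such a point a Wronskian comparison with the initial solution
gives `z < 0`, which contradicts `z(c) ≥ 0` at `c` and `y ≥ 0` just to the right anywhere else. So
at `λ₁` the solution is positive with `z(c) ≥ 0` (`exists_pos_isInitialSolution`).

The quotient `z / y` then satisfies the Riccati equation `(z/y)^Δ = q - λ₁ - z² / (y y^σ)`.
Integrated from `a` to `c`, the term `q - λ₁` vanishes by the mean value hypothesis, so a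
nonnegative number equals minus a nonnegative integral. Hence `z = 0` and `q = λ₁` on `[a, c)`
(`IsInitialSolution.eq_of_mean`). If `c` belongs to `T^{k²}`, it is left-dense and continuity of `q`
settles it.

Existence and continuity in `l` come from a Picard operator contracting in an exponentially weighted
norm; delta integrals are realized as Lebesgue integrals of `f ∘ ρ`. -/

/-! ### Jump operators. -/

theorem le_sigma (T : Set ℝ) (x : ℝ) : x ≤ sigma T x := by
  unfold sigma
  split_ifs with h
  · obtain ⟨s, hs, hxs⟩ := h
    exact le_csInf ⟨s, hs, hxs⟩ fun r hr => hr.2.le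
  · exact le_rfl

theorem rho_le (T : Set ℝ) (x : ℝ) : rho T x ≤ x := by
  unfold rho
  split_ifs with h
  · obtain ⟨s, hs, hxs⟩ := h
    exact csSup_le ⟨s, hs, hxs⟩ fun r hr => hr.2.le
  · exact le_rfl

theorem sigma_le {x s : ℝ} (hs : s ∈ T) (h : x < s) : sigma T x ≤ s := by
  unfold sigma
  rw [if_pos ⟨s, hs, h⟩]
  exact csInf_le ⟨x, fun r hr => hr.2.le⟩ ⟨hs, h⟩

theorem le_rho {x s : ℝ} (hs : s ∈ T) (h : s < x) : s ≤ rho T x := by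
  unfold rho
  rw [if_pos ⟨s, hs, h⟩]
  exact le_csSup ⟨x, fun r hr => hr.2.le⟩ ⟨hs, h⟩

theorem sigma_mem (hT : IsClosed T) (ht : t ∈ T) : sigma T t ∈ T := by
  unfold sigma
  split_ifs with h
  · obtain ⟨s, hs, hxs⟩ := h
    have hmem : sInf {s | s ∈ T ∧ t < s} ∈ closure {s | s ∈ T ∧ t < s} :=
      csInf_mem_closure ⟨s, hs, hxs⟩ ⟨t, fun r hr => hr.2.le⟩
    exact hT.closure_subset_iff.2 (fun r hr => hr.1) hmem
  · exact ht

theorem rho_mem (hT : IsClosed T) {x s : ℝ} (hs : s ∈ T) (h : s < x) : rho T x ∈ T := by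
  unfold rho
  rw [if_pos ⟨s, hs, h⟩]
  have hmem : sSup {s | s ∈ T ∧ s < x} ∈ closure {s | s ∈ T ∧ s < x} :=
    csSup_mem_closure ⟨s, hs, h⟩ ⟨x, fun r hr => hr.2.le⟩
  exact hT.closure_subset_iff.2 (fun r hr => hr.1) hmem

theorem sigma_monotone (T : Set ℝ) : Monotone (sigma T) := by
  intro x y hxy
  by_cases h : ∃ s ∈ T, y < s
  · have h' := h
    obtain ⟨s, hs, hys⟩ := h
    conv_rhs => unfold sigma
    rw [if_pos h']
    exact le_csInf ⟨s, hs, hys⟩ fun r hr => sigma_le hr.1 (hxy.trans_lt hr.2)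
  · have hy : sigma T y = y := by unfold sigma; rw [if_neg h]
    by_cases hx : ∃ s ∈ T, x < s
    · obtain ⟨s, hs, hxs⟩ := hx
      have : s ≤ y := not_lt.1 fun h' => h ⟨s, hs, h'⟩
      rw [hy]
      exact (sigma_le hs hxs).trans this
    · have : sigma T x = x := by unfold sigma; rw [if_neg hx]
      rw [this, hy]; exact hxy

theorem rho_monotone (T : Set ℝ) : Monotone (rho T) := by
  intro x y hxy
  by_cases h : ∃ s ∈ T, s < x
  · have h' := h
    obtain ⟨s, hs, hys⟩ := h
    conv_lhs => unfold rho
    rw [if_pos h']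
    exact csSup_le ⟨s, hs, hys⟩ fun r hr => le_rho hr.1 (hr.2.trans_le hxy)
  · have hx : rho T x = x := by unfold rho; rw [if_neg h]
    by_cases hy : ∃ s ∈ T, s < y
    · obtain ⟨s, hs, hsy⟩ := hy
      have : x ≤ s := not_lt.1 fun h' => h ⟨s, hs, h'⟩
      rw [hx]
      exact this.trans (le_rho hs hsy)
    · have : rho T y = y := by unfold rho; rw [if_neg hy]
      rw [this, hx]; exact hxy

/-- The gap `(t, σ t)` contains no point of `T`. This makes `f ∘ ρ` constant on gaps, as a delta
integrand must be. -/
theorem rho_eq_of_mem_Ioc {x : ℝ} (ht : t ∈ T) (hx : x ∈ Ioc t (sigma T t)) : rho T x = t := by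
  refine le_antisymm ?_ (le_rho ht hx.1)
  unfold rho
  rw [if_pos ⟨t, ht, hx.1⟩]
  refine csSup_le ⟨t, ht, hx.1⟩ fun r hr => not_lt.1 fun h => ?_
  exact absurd (sigma_le hr.1 h) (not_le.2 (hr.2.trans_le hx.2))

theorem exists_mem_Ioo_of_sigma_eq {v r : ℝ} (h : sigma T t = t) (hv : v ∈ T) (htv : t < v)
    (hr : t < r) : ∃ s ∈ T, s ∈ Ioo t r := by
  by_contra! hcon
  have h1 : r ≤ sigma T t := by
    unfold sigma
    rw [if_pos ⟨v, hv, htv⟩]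
    refine le_csInf ⟨v, hv, htv⟩ fun s hs => not_lt.1 fun hsr => ?_
    exact hcon s hs.1 ⟨hs.2, hsr⟩
  linarith

/-! ### Rules for the delta derivative. -/

theorem HasDeltaDerivAt.sigma_sub {f : ℝ → ℝ} {d : ℝ} (h : HasDeltaDerivAt T f d t) (ht : t ∈ T) :
    f (sigma T t) - f t = d * (sigma T t - t) := by
  have key : ∀ ε : ℝ, 0 < ε →
      |(f (sigma T t) - f t) - d * (sigma T t - t)| ≤ ε * |sigma T t - t| := by
    intro ε hε
    obtain ⟨δ, hδ, H⟩ := h ε hε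
    exact H t ht ⟨by linarith, by linarith⟩
  rcases (le_sigma T t).eq_or_lt with h0 | h0
  · rw [← h0]; simp
  · by_contra hne
    have hpos : 0 < |(f (sigma T t) - f t) - d * (sigma T t - t)| := abs_pos.2 (sub_ne_zero.2 hne)
    have hμ : 0 < |sigma T t - t| := abs_pos.2 (by linarith)
    have := key (|(f (sigma T t) - f t) - d * (sigma T t - t)| / (2 * |sigma T t - t|))
      (by positivity)
    have e : |(f (sigma T t) - f t) - d * (sigma T t - t)| / (2 * |sigma T t - t|)
        * |sigma T t - t| = |(f (sigma T t) - f t) - d * (sigma T t - t)| / 2 := by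
      field_simp
    rw [e] at this
    linarith

theorem hasDeltaDerivAt_iff_of_sigma_eq {f : ℝ → ℝ} {d : ℝ} (h : sigma T t = t) :
    HasDeltaDerivAt T f d t ↔ HasDerivWithinAt f d T t := by
  rw [hasDerivWithinAt_iff_isLittleO, Asymptotics.isLittleO_iff]
  unfold HasDeltaDerivAt
  rw [h]
  refine forall_congr' fun ε => forall_congr' fun hε => ?_
  rw [(nhdsWithin_hasBasis (nhds_basis_Ioo_pos t) T).eventually_iff]
  refine exists_congr fun δ => and_congr_right fun hδ => ?_
  constructor
  · rintro H x ⟨hx1, hx2⟩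
    have := H x hx2 hx1
    rw [Real.norm_eq_abs, Real.norm_eq_abs, abs_sub_comm x t, smul_eq_mul,
      ← abs_neg (f x - _ - _)]
    convert this using 2; ring
  · intro H x hx2 hx1
    have := H ⟨hx1, hx2⟩
    rw [Real.norm_eq_abs, Real.norm_eq_abs, abs_sub_comm x t, smul_eq_mul,
      ← abs_neg (f x - _ - _)] at this
    convert this using 2; ring

/-- Near a right-scattered point `|σ t - s|` stays away from zero, so the defining estimate amounts
to its exact value at `s = t` together with continuity. Together with the right-dense case, this
reduces each rule below to a classical one or to algebra. -/
theorem hasDeltaDerivAt_iff_of_lt_sigma {f : ℝ → ℝ} {d : ℝ} (ht : t ∈ T) (h : t < sigma T t) :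
    HasDeltaDerivAt T f d t ↔
      f (sigma T t) - f t = d * (sigma T t - t) ∧ ContinuousWithinAt f T t := by
  obtain ⟨μ, hμ⟩ : ∃ μ : ℝ, μ = sigma T t - t := ⟨_, rfl⟩
  have hμ0 : 0 < μ := by linarith
  constructor
  · intro H
    have h1 := H.sigma_sub ht
    refine ⟨h1, ?_⟩
    rw [Metric.continuousWithinAt_iff]
    intro ε hε
    have hden : 0 < 2 * (μ + 1) := by positivity
    obtain ⟨δ, hδ, Hδ⟩ := H (ε / (2 * (μ + 1))) (by positivity)
    set δ' := min δ (min 1 (ε / (2 * (|d| + 1)))) with hδ'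
    have hδ'0 : 0 < δ' := by positivity
    refine ⟨δ', hδ'0, fun {s} hs hst => ?_⟩
    rw [Real.dist_eq] at hst ⊢
    have hs1 : |s - t| < δ := hst.trans_le (min_le_left _ _)
    have hs2 : |s - t| < 1 := hst.trans_le ((min_le_right _ _).trans (min_le_left _ _))
    have hs3 : |s - t| < ε / (2 * (|d| + 1)) :=
      hst.trans_le ((min_le_right _ _).trans (min_le_right _ _))
    have hb := Hδ s hs ⟨by linarith [(abs_lt.1 hs1).1], by linarith [(abs_lt.1 hs1).2]⟩
    have hb1 : |sigma T t - s| ≤ μ + 1 := by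
      have : sigma T t - s = μ - (s - t) := by rw [hμ]; ring
      rw [this]
      calc |μ - (s - t)| ≤ |μ| + |s - t| := abs_sub _ _
        _ ≤ μ + 1 := by rw [abs_of_pos hμ0]; linarith
    have hb2 : ε / (2 * (μ + 1)) * |sigma T t - s| ≤ ε / 2 := by
      calc ε / (2 * (μ + 1)) * |sigma T t - s| ≤ ε / (2 * (μ + 1)) * (μ + 1) := by gcongr
        _ = ε / 2 := by field_simp
    have hb3 : |d| * |s - t| < ε / 2 := by
      have h3 : |d| * |s - t| ≤ (|d| + 1) * |s - t| := by
        gcongr; linarith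
      have h4 : (|d| + 1) * |s - t| < (|d| + 1) * (ε / (2 * (|d| + 1))) := by
        gcongr
      have h5 : (|d| + 1) * (ε / (2 * (|d| + 1))) = ε / 2 := by
        have : |d| + 1 ≠ 0 := by positivity
        field_simp
      linarith
    have e : f s - f t = -((f (sigma T t) - f s) - d * (sigma T t - s)) + d * (s - t) := by
      linear_combination h1
    rw [e]
    calc _ ≤ |-((f (sigma T t) - f s) - d * (sigma T t - s))| + |d * (s - t)| := abs_add_le _ _
      _ < ε := by rw [abs_neg, abs_mul]; linarith
  · rintro ⟨h1, h2⟩ ε hε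
    have hc : ContinuousWithinAt (fun s => |(f (sigma T t) - f s) - d * (sigma T t - s)|
        - ε * |sigma T t - s|) T t := by fun_prop
    have h0 : |(f (sigma T t) - f t) - d * (sigma T t - t)| - ε * |sigma T t - t| < 0 := by
      rw [h1, sub_self, abs_zero, abs_of_pos (by linarith), zero_sub]
      have : 0 < ε * (sigma T t - t) := by rw [← hμ]; positivity
      linarith
    have hev := hc.eventually (gt_mem_nhds h0)
    rw [(nhdsWithin_hasBasis (nhds_basis_Ioo_pos t) T).eventually_iff] at hev
    obtain ⟨δ, hδ, H⟩ := hev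
    refine ⟨δ, hδ, fun s hs hs' => ?_⟩
    have := H ⟨hs', hs⟩
    linarith

theorem HasDeltaDerivAt.continuousWithinAt {f : ℝ → ℝ} {d : ℝ} (h : HasDeltaDerivAt T f d t)
    (ht : t ∈ T) : ContinuousWithinAt f T t := by
  rcases (le_sigma T t).eq_or_lt with h0 | h0
  · exact ((hasDeltaDerivAt_iff_of_sigma_eq h0.symm).1 h).continuousWithinAt
  · exact ((hasDeltaDerivAt_iff_of_lt_sigma ht h0).1 h).2

theorem HasDeltaDerivAt.mul {f g : ℝ → ℝ} {d e : ℝ} (hf : HasDeltaDerivAt T f d t)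
    (hg : HasDeltaDerivAt T g e t) (ht : t ∈ T) :
    HasDeltaDerivAt T (fun s => f s * g s) (d * g t + f (sigma T t) * e) t := by
  rcases (le_sigma T t).eq_or_lt with h0 | h0
  · rw [hasDeltaDerivAt_iff_of_sigma_eq h0.symm] at *
    rw [← h0]
    exact HasDerivWithinAt.fun_mul hf hg
  · rw [hasDeltaDerivAt_iff_of_lt_sigma ht h0] at *
    refine ⟨?_, hf.2.mul hg.2⟩
    linear_combination g t * hf.1 + f (sigma T t) * hg.1

theorem HasDeltaDerivAt.div {f g : ℝ → ℝ} {d e : ℝ} (hf : HasDeltaDerivAt T f d t)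
    (hg : HasDeltaDerivAt T g e t) (ht : t ∈ T) (h1 : g t ≠ 0) (h2 : g (sigma T t) ≠ 0) :
    HasDeltaDerivAt T (fun s => f s / g s) ((d * g t - f t * e) / (g t * g (sigma T t))) t := by
  rcases (le_sigma T t).eq_or_lt with h0 | h0
  · rw [hasDeltaDerivAt_iff_of_sigma_eq h0.symm] at *
    rw [← h0, ← sq]
    exact HasDerivWithinAt.fun_div hf hg h1
  · rw [hasDeltaDerivAt_iff_of_lt_sigma ht h0] at *
    refine ⟨?_, hf.2.div hg.2 h1⟩
    field_simp
    linear_combination g t * hf.1 - f t * hg.1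

theorem HasDeltaDerivAt.sub {f g : ℝ → ℝ} {d e : ℝ} (hf : HasDeltaDerivAt T f d t)
    (hg : HasDeltaDerivAt T g e t) (ht : t ∈ T) :
    HasDeltaDerivAt T (fun s => f s - g s) (d - e) t := by
  rcases (le_sigma T t).eq_or_lt with h0 | h0
  · rw [hasDeltaDerivAt_iff_of_sigma_eq h0.symm] at *
    exact HasDerivWithinAt.fun_sub hf hg
  · rw [hasDeltaDerivAt_iff_of_lt_sigma ht h0] at *
    refine ⟨?_, hf.2.sub hg.2⟩
    linear_combination hf.1 - hg.1

theorem hasDeltaDerivAt_const_mul_id (T : Set ℝ) (m t : ℝ) :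
    HasDeltaDerivAt T (fun s => m * s) m t := by
  intro ε hε
  refine ⟨1, one_pos, fun s _ _ => ?_⟩
  rw [← mul_sub, sub_self, abs_zero]
  positivity

theorem HasDeltaDerivAt.neg {f : ℝ → ℝ} {d : ℝ} (hf : HasDeltaDerivAt T f d t) :
    HasDeltaDerivAt T (fun s => -f s) (-d) t := by
  intro ε hε
  obtain ⟨δ, hδ, H⟩ := hf ε hε
  refine ⟨δ, hδ, fun s hs hs' => ?_⟩
  have := H s hs hs'
  rw [← abs_neg]
  convert this using 2
  ring

/-! ### Monotonicity from the sign of the delta derivative. -/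

/-- A function with delta derivative larger than `e` at `t` grows at rate at least `e` on some
step to the right of `t`. -/
theorem HasDeltaDerivAt.exists_add_le {f : ℝ → ℝ} {d e v : ℝ} (hT : IsClosed T)
    (hf : HasDeltaDerivAt T f d t) (ht : t ∈ T) (hv : v ∈ T) (htv : t < v) (hed : e < d) :
    ∃ s ∈ T, s ∈ Ioc t v ∧ f t + e * (s - t) ≤ f s := by
  rcases (le_sigma T t).eq_or_lt with h0 | h0
  -- The tolerance `d - e` is exactly the slope that may be lost.
  · obtain ⟨δ, hδ, H⟩ := hf (d - e) (by linarith)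
    obtain ⟨s, hs, hs1, hs2⟩ := exists_mem_Ioo_of_sigma_eq (r := min v (t + δ)) h0.symm hv htv
      (lt_min htv (by linarith))
    have h3 := H s hs ⟨by linarith, hs2.trans_le (min_le_right _ _)⟩
    rw [← h0, abs_of_neg (show t - s < 0 by linarith)] at h3
    refine ⟨s, hs, ⟨hs1, (hs2.trans_le (min_le_left _ _)).le⟩, ?_⟩
    have := (abs_le.1 h3).2
    linarith
  · refine ⟨sigma T t, sigma_mem hT ht, ⟨h0, sigma_le hv htv⟩, ?_⟩
    have := hf.sigma_sub ht
    nlinarith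

/-- Real induction along `[u, v]`. The slope `-ε` leaves the strict margin needed to step right from
any point of `T`; then `ε → 0`. -/
theorem le_of_hasDeltaDerivAt_nonneg {f f' : ℝ → ℝ} {u v : ℝ} (hT : IsClosed T) (hu : u ∈ T)
    (hv : v ∈ T) (huv : u ≤ v) (hcont : ContinuousOn f (T ∩ Icc u v))
    (hf : ∀ t ∈ T, t ∈ Ico u v → HasDeltaDerivAt T f (f' t) t)
    (hf' : ∀ t ∈ T, t ∈ Ico u v → 0 ≤ f' t) : f u ≤ f v := by
  have key : ∀ ε : ℝ, 0 < ε → f u ≤ f v + ε * (v - u) := by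
    intro ε hε
    have hmem : v ∈ {t | t ∈ T ∧ f u ≤ f t + ε * (t - u)} := by
      refine IsClosed.mem_of_ge_of_forall_exists_gt (a := u) ?_ ?_ huv ?_
      · have : {t | t ∈ T ∧ f u ≤ f t + ε * (t - u)} ∩ Icc u v
            = (T ∩ Icc u v) ∩ {t | f u ≤ f t + ε * (t - u)} := by
          ext; simp only [mem_inter_iff, mem_ofPred_eq]; tauto
        rw [this]
        have hc : ContinuousOn (fun t => f t + ε * (t - u)) (T ∩ Icc u v) := by fun_prop
        exact hc.preimage_isClosed_of_isClosed (hT.inter isClosed_Icc) isClosed_Ici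
      · exact ⟨hu, by simp⟩
      · rintro x ⟨⟨hx, hfx⟩, hxuv⟩
        obtain ⟨s, hs, hsx, hfs⟩ := (hf x hx hxuv).exists_add_le (e := -ε) hT hx hv hxuv.2
          (by linarith [hf' x hx hxuv])
        exact ⟨s, ⟨hs, by linarith⟩, hsx⟩
    exact hmem.2
  refine le_of_forall_pos_le_add fun ε hε => ?_
  -- The summand 1 covers the case `u = v`.
  have := key (ε / (v - u + 1)) (div_pos hε (by linarith))
  have h2 : ε / (v - u + 1) * (v - u) ≤ ε := by
    rw [div_mul_eq_mul_div, div_le_iff₀ (by linarith)]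
    nlinarith
  linarith

/-! ### Delta integrals as Lebesgue integrals of `f ∘ ρ`. -/

theorem continuousWithinAt_sigma (h : sigma T t = t) :
    ContinuousWithinAt (sigma T) T t := by
  rw [Metric.continuousWithinAt_iff]
  intro ε hε
  rw [h]
  by_cases hex : ∃ v ∈ T, t < v
  · obtain ⟨v, hv, htv⟩ := hex
    obtain ⟨r, hr, hr1, hr2⟩ := exists_mem_Ioo_of_sigma_eq (r := t + ε) h hv htv (by linarith)
    refine ⟨min ε (r - t), lt_min hε (by linarith), fun {s} hs hst => ?_⟩
    rw [Real.dist_eq] at hst ⊢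
    have h1 := abs_lt.1 (hst.trans_le (min_le_left _ _))
    have h2 := abs_lt.1 (hst.trans_le (min_le_right _ _))
    have h3 := le_sigma T s
    have h4 := sigma_le hr (show s < r by linarith)
    rw [abs_lt]; constructor <;> linarith
  · refine ⟨ε, hε, fun {s} hs hst => ?_⟩
    rw [Real.dist_eq] at hst ⊢
    have h1 := abs_lt.1 hst
    have h3 := le_sigma T s
    have hs' : s ≤ t := not_lt.1 fun h' => hex ⟨s, hs, h'⟩
    have h4 : sigma T s ≤ t := h ▸ sigma_monotone T hs'
    rw [abs_lt]; constructor <;> linarith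

/-- Monotone maps are Borel and send a bounded interval into a bounded one, so the integrand is
measurable and bounded. -/
theorem intervalIntegrable_comp_monotone {k : ℝ → ℝ → ℝ} (hk : Continuous (Function.uncurry k))
    {m n : ℝ → ℝ} (hm : Monotone m) (hn : Monotone n) (u v : ℝ) :
    IntervalIntegrable (fun x => k (m x) (n x)) volume u v := by
  have hcomp : IsCompact (Icc (m (min u v)) (m (max u v)) ×ˢ Icc (n (min u v)) (n (max u v))) :=
    isCompact_Icc.prod isCompact_Icc
  obtain ⟨C, hC⟩ := hcomp.exists_bound_of_continuousOn hk.continuousOn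
  have hmeas : Measurable (fun x => k (m x) (n x)) :=
    hk.measurable.comp (hm.measurable.prodMk hn.measurable)
  refine IntervalIntegrable.mono_fun' (g := fun _ => C) (by simp)
    hmeas.aestronglyMeasurable ?_
  refine (ae_restrict_iff' measurableSet_uIoc).2 (Eventually.of_forall fun x hx => ?_)
  have h1 : min u v ≤ x := hx.1.le
  have h2 : x ≤ max u v := hx.2
  exact hC (m x, n x) ⟨⟨hm h1, hm h2⟩, ⟨hn h1, hn h2⟩⟩

theorem intervalIntegrable_comp_rho (T : Set ℝ) {h : ℝ → ℝ} (hh : Continuous h) (u v : ℝ) :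
    IntervalIntegrable (fun x => h (rho T x)) volume u v :=
  intervalIntegrable_comp_monotone (k := fun r _ => h r) (hh.comp continuous_fst)
    (rho_monotone T) (rho_monotone T) u v

theorem intervalIntegrable_mul_comp_sigma_rho (T : Set ℝ) {g h : ℝ → ℝ} (hg : Continuous g)
    (hh : Continuous h) (u v : ℝ) :
    IntervalIntegrable (fun x => g (rho T x) * h (sigma T (rho T x))) volume u v :=
  intervalIntegrable_comp_monotone (k := fun r s => g r * h s)
    ((hg.comp continuous_fst).mul (hh.comp continuous_snd))
    (rho_monotone T) ((sigma_monotone T).comp (rho_monotone T)) u v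

/-- For `x` between two points `t`, `s` of `T`, the point `ρ x` lies in `T` and again between them,
so `f (ρ x)` is close to `f t`. The set `U` allows one-sided derivatives, needed at the maximum of
`T^k`. -/
theorem hasDerivWithinAt_integral_comp_rho {f : ℝ → ℝ} {a : ℝ} {U : Set ℝ} (hT : IsClosed T)
    (hint : ∀ u v, IntervalIntegrable (fun x => f (rho T x)) volume u v) (hU : U.OrdConnected)
    (ht : t ∈ T ∩ U) (hf : ContinuousWithinAt f (T ∩ U) t) :
    HasDerivWithinAt (fun s => ∫ x in a..s, f (rho T x)) (f t) (T ∩ U) t := by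
  rw [hasDerivWithinAt_iff_isLittleO, Asymptotics.isLittleO_iff]
  intro ε hε
  obtain ⟨δ, hδ, H⟩ := Metric.continuousWithinAt_iff.1 hf ε hε
  filter_upwards [self_mem_nhdsWithin, mem_nhdsWithin_of_mem_nhds (Metric.ball_mem_nhds t hδ)]
    with s hs hst
  rw [intervalIntegral.integral_interval_sub_left (hint _ _) (hint _ _)]
  have e : ∫ x in t..s, f (rho T x) - f t = (∫ x in t..s, f (rho T x)) - (s - t) • f t := by
    rw [intervalIntegral.integral_sub (hint _ _) (by simp), intervalIntegral.integral_const]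
  rw [← e]
  refine intervalIntegral.norm_integral_le_of_norm_le_const fun x hx => ?_
  have hp : min t s ∈ T := by rcases min_choice t s with h | h <;> rw [h]; exacts [ht.1, hs.1]
  have hx1 : min t s ≤ rho T x := le_rho hp hx.1
  have hx2 : rho T x ≤ max t s := (rho_le T x).trans hx.2
  have hmem : rho T x ∈ T ∩ U := ⟨rho_mem hT hp hx.1, hU.uIcc_subset ht.2 hs.2 ⟨hx1, hx2⟩⟩
  refine (H hmem ?_).le
  refine lt_of_le_of_lt ?_ (Metric.mem_ball.1 hst)
  rw [Real.dist_eq, Real.dist_eq]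
  exact abs_sub_left_of_mem_uIcc ⟨hx1, hx2⟩

theorem hasDeltaDerivAt_integral_comp_rho {f : ℝ → ℝ} {a : ℝ} (hT : IsClosed T)
    (hint : ∀ u v, IntervalIntegrable (fun x => f (rho T x)) volume u v) (ht : t ∈ T)
    (hf : sigma T t = t → ContinuousWithinAt f T t) :
    HasDeltaDerivAt T (fun s => ∫ x in a..s, f (rho T x)) (f t) t := by
  rcases (le_sigma T t).eq_or_lt with h0 | h0
  · rw [hasDeltaDerivAt_iff_of_sigma_eq h0.symm]
    have := hasDerivWithinAt_integral_comp_rho (U := univ) (a := a) hT hint ordConnected_univ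
      ⟨ht, mem_univ t⟩ (by simpa using hf h0.symm)
    simpa using this
  · rw [hasDeltaDerivAt_iff_of_lt_sigma ht h0]
    refine ⟨?_, (intervalIntegral.continuous_primitive hint a).continuousWithinAt⟩
    rw [intervalIntegral.integral_interval_sub_left (hint _ _) (hint _ _)]
    have : ∫ x in t..sigma T t, f (rho T x) = ∫ _ in t..sigma T t, f t := by
      refine intervalIntegral.integral_congr_ae (Eventually.of_forall fun x hx => ?_)
      rw [uIoc_of_le h0.le] at hx
      rw [rho_eq_of_mem_Ioc ht hx]
    rw [this, intervalIntegral.integral_const, smul_eq_mul, mul_comm]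

theorem rho_mem_of_mem_Icc {a b x : ℝ} (hT : IsClosed T) (ha : a ∈ T)
    (hab : ∀ s ∈ T, s ∈ Icc a b) (hx : x ∈ Icc a b) : rho T x ∈ T := by
  rcases hx.1.eq_or_lt with h | h
  · subst h
    have : rho T a = a := by
      unfold rho
      rw [if_neg]
      rintro ⟨s, hs, hsa⟩
      exact absurd (hab s hs).1 (not_le.2 hsa)
    rwa [this]
  · exact rho_mem hT ha h

theorem HasDeltaDerivAt.congr {f g : ℝ → ℝ} {d : ℝ} (hf : HasDeltaDerivAt T f d t)
    (hT : IsClosed T) (ht : t ∈ T) (hfg : EqOn g f T) : HasDeltaDerivAt T g d t := by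
  intro ε hε
  obtain ⟨δ, hδ, H⟩ := hf ε hε
  refine ⟨δ, hδ, fun s hs hs' => ?_⟩
  rw [hfg hs, hfg (sigma_mem hT ht)]
  exact H s hs hs'

/-- The delta integral of `f` from `a` to `t`, as a Lebesgue integral. -/
noncomputable def deltaPrimitive (T : Set ℝ) (a : ℝ) (f : ℝ → ℝ) (t : ℝ) : ℝ :=
  ∫ x in a..t, f (rho T x)

theorem continuous_deltaPrimitive {f : ℝ → ℝ} (a : ℝ)
    (hf : ∀ u v, IntervalIntegrable (fun x => f (rho T x)) volume u v) :
    Continuous (deltaPrimitive T a f) :=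
  intervalIntegral.continuous_primitive hf a

theorem deltaPrimitive_sub {f g : ℝ → ℝ} (a : ℝ)
    (hf : ∀ u v, IntervalIntegrable (fun x => f (rho T x)) volume u v)
    (hg : ∀ u v, IntervalIntegrable (fun x => g (rho T x)) volume u v) :
    deltaPrimitive T a (fun s => f s - g s)
      = fun t => deltaPrimitive T a f t - deltaPrimitive T a g t := by
  funext t
  exact intervalIntegral.integral_sub (hf _ _) (hg _ _)

theorem deltaPrimitive_nonneg {f : ℝ → ℝ} {a b : ℝ} (hT : IsClosed T) (ha : a ∈ T)
    (hab : ∀ s ∈ T, s ∈ Icc a b) (hf : ∀ s ∈ T, 0 ≤ f s) (ht : t ∈ Icc a b) :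
    0 ≤ deltaPrimitive T a f t :=
  intervalIntegral.integral_nonneg ht.1 fun _ hx =>
    hf _ (rho_mem_of_mem_Icc hT ha hab ⟨hx.1, hx.2.trans ht.2⟩)

/-! ### Picard iteration in a weighted norm. -/

/-- The second-order Volterra operator with kernel `p` contracts the exponentially weighted
supremum norm of weight `M` by the factor `C * (b - a) / M`. -/
theorem abs_deltaPrimitive_deltaPrimitive_le {p h : ℝ → ℝ} {a b C M N : ℝ} (hT : IsClosed T)
    (ha : a ∈ T) (hab : ∀ s ∈ T, s ∈ Icc a b) (hC : 0 ≤ C) (hM : 0 < M) (hN : 0 ≤ N)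
    (hp : ∀ s ∈ T, |p s| ≤ C) (hh : ∀ s ∈ T, |h s| ≤ N * Real.exp (M * (s - a)))
    (ht : t ∈ Icc a b) :
    |deltaPrimitive T a (deltaPrimitive T a fun s => p s * h (sigma T s)) t|
      ≤ C * (b - a) / M * N * Real.exp (M * (t - a)) := by
  have hba : a ≤ b := (hab a ha).2
  have inner : ∀ r ∈ T, |deltaPrimitive T a (fun s => p s * h (sigma T s)) r|
      ≤ C * (b - a) * N * Real.exp (M * (r - a)) := by
    intro r hr
    have har := (hab r hr).1
    have hrb := (hab r hr).2
    have h1 : ‖∫ x in a..r, p (rho T x) * h (sigma T (rho T x))‖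
        ≤ C * (N * Real.exp (M * (r - a))) * |r - a| := by
      refine intervalIntegral.norm_integral_le_of_norm_le_const_ae ?_
      -- The endpoint must be discarded: if `r` is left-dense and right-scattered, then `σ (ρ r) = σ
      -- r > r`. For `x < r` one has `σ (ρ x) ≤ r`.
      have hne : ∀ᵐ x : ℝ, x ≠ r := by
        simp [ae_iff, measure_singleton]
      filter_upwards [hne] with x hx hxr
      rw [uIoc_of_le har] at hxr
      have hmem : rho T x ∈ T := rho_mem hT ha hxr.1
      have hσ : sigma T (rho T x) ∈ T := sigma_mem hT hmem
      have hσr : sigma T (rho T x) ≤ r :=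
        sigma_le hr ((rho_le T x).trans_lt (lt_of_le_of_ne hxr.2 hx))
      rw [norm_mul, Real.norm_eq_abs, Real.norm_eq_abs]
      refine mul_le_mul (hp _ hmem) ((hh _ hσ).trans ?_) (abs_nonneg _) hC
      gcongr
    rw [abs_of_nonneg (by linarith), Real.norm_eq_abs] at h1
    refine h1.trans ?_
    have : 0 ≤ C * (N * Real.exp (M * (r - a))) := by positivity
    calc C * (N * Real.exp (M * (r - a))) * (r - a)
        ≤ C * (N * Real.exp (M * (r - a))) * (b - a) := by gcongr
      _ = _ := by ring
  have hexp : Continuous fun s => Real.exp (M * (s - a)) := by fun_prop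
  -- The inner bound keeps its exponential; integrating it is what produces the factor `1 / M`.
  have houter : ‖∫ s in a..t, deltaPrimitive T a (fun s => p s * h (sigma T s)) (rho T s)‖
      ≤ ∫ s in a..t, C * (b - a) * N * Real.exp (M * (s - a)) := by
    refine intervalIntegral.norm_integral_le_of_norm_le ht.1
      (Eventually.of_forall fun s hs => ?_) ((hexp.const_mul _).intervalIntegrable _ _)
    refine (inner _ (rho_mem hT ha hs.1)).trans ?_
    have := rho_le T s
    have h0 : 0 ≤ C * (b - a) * N := by
      have : 0 ≤ b - a := by linarith
      positivity
    gcongr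
  have hint : ∫ s in a..t, C * (b - a) * N * Real.exp (M * (s - a))
      = C * (b - a) * N / M * (Real.exp (M * (t - a)) - 1) := by
    have hd : ∀ s ∈ uIcc a t, HasDerivAt
        (fun s => C * (b - a) * N / M * Real.exp (M * (s - a)))
        (C * (b - a) * N * Real.exp (M * (s - a))) s := by
      intro s _
      have h1 : HasDerivAt (fun s => M * (s - a)) M s := by
        simpa using ((hasDerivAt_id s).sub_const a).const_mul M
      have h2 := h1.exp.const_mul (C * (b - a) * N / M)
      exact h2.congr_deriv (by field_simp)
    rw [intervalIntegral.integral_eq_sub_of_hasDerivAt hd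
      ((hexp.const_mul _).intervalIntegrable _ _)]
    simp
    ring
  rw [hint] at houter
  refine houter.trans ?_
  have h0 : 0 ≤ C * (b - a) * N / M := by
    have : 0 ≤ b - a := by linarith
    positivity
  calc _ ≤ C * (b - a) * N / M * Real.exp (M * (t - a)) := by
        gcongr; linarith
    _ = _ := by ring

/-- The extension to `ℝ` of a function on an interval, times an exponential weight. -/
noncomputable def weighted {a b : ℝ} (hab : a ≤ b) (M : ℝ) (u : C(Icc a b, ℝ)) (x : ℝ) : ℝ :=
  Real.exp (M * (x - a)) * IccExtend hab u x

theorem continuous_weighted {a b : ℝ} (hab : a ≤ b) (M : ℝ) (u : C(Icc a b, ℝ)) :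
    Continuous (weighted hab M u) := by
  have := u.continuous.Icc_extend' (h := hab)
  unfold weighted
  fun_prop

theorem weighted_of_mem {a b : ℝ} (hab : a ≤ b) (M : ℝ) (u : C(Icc a b, ℝ)) {x : ℝ}
    (hx : x ∈ Icc a b) : weighted hab M u x = Real.exp (M * (x - a)) * u ⟨x, hx⟩ := by
  rw [weighted, IccExtend_of_mem _ _ hx]

theorem abs_weighted_le {a b : ℝ} (hab : a ≤ b) (M : ℝ) (u : C(Icc a b, ℝ)) (x : ℝ) :
    |weighted hab M u x| ≤ ‖u‖ * Real.exp (M * (x - a)) := by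
  rw [weighted, abs_mul, abs_of_pos (Real.exp_pos _), mul_comm]
  gcongr
  exact u.norm_coe_le_norm _

theorem weighted_sub {a b : ℝ} (hab : a ≤ b) (M : ℝ) (u v : C(Icc a b, ℝ)) (x : ℝ) :
    weighted hab M (u - v) x = weighted hab M u x - weighted hab M v x := by
  simp only [weighted, IccExtend, Function.comp_apply, ContinuousMap.sub_apply]
  ring

theorem continuous_deltaPrimitive_weighted {a b : ℝ} (T : Set ℝ) (hab : a ≤ b) (M : ℝ)
    {p : ℝ → ℝ} (hp : Continuous p) (u : C(Icc a b, ℝ)) :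
    Continuous (deltaPrimitive T a fun s => p s * weighted hab M u (sigma T s)) :=
  continuous_deltaPrimitive a
    (intervalIntegrable_mul_comp_sigma_rho T hp (continuous_weighted hab M u))

/-- The Picard operator of the problem `y^ΔΔ = p y^σ`, `y(a) = 1`, `y^Δ(a) = 0`, conjugated by
an exponential weight. -/
noncomputable def picard (T : Set ℝ) {a b : ℝ} (hab : a ≤ b) (M : ℝ) (p : C(ℝ, ℝ))
    (u : C(Icc a b, ℝ)) : C(Icc a b, ℝ) where
  toFun t := Real.exp (-(M * (t - a))) * (1 + deltaPrimitive T a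
    (deltaPrimitive T a fun s => p s * weighted hab M u (sigma T s)) t)
  continuous_toFun := by
    have := continuous_deltaPrimitive (T := T) a (intervalIntegrable_comp_rho T
      (continuous_deltaPrimitive_weighted T hab M p.continuous u))
    fun_prop

theorem picard_sub_picard_apply {a b : ℝ} (T : Set ℝ) (hab : a ≤ b) (M : ℝ) (p : C(ℝ, ℝ))
    (u v : C(Icc a b, ℝ)) (t : Icc a b) :
    picard T hab M p u t - picard T hab M p v t = Real.exp (-(M * (t - a))) *
      deltaPrimitive T a
        (deltaPrimitive T a fun s => p s * weighted hab M (u - v) (sigma T s)) t := by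
  have h1 : (fun s => p s * weighted hab M (u - v) (sigma T s)) = fun s =>
      p s * weighted hab M u (sigma T s) - p s * weighted hab M v (sigma T s) := by
    funext s; rw [weighted_sub]; ring
  rw [h1, deltaPrimitive_sub, deltaPrimitive_sub]
  · simp only [picard, ContinuousMap.coe_mk]; ring
  · exact intervalIntegrable_comp_rho T
      (continuous_deltaPrimitive_weighted T hab M p.continuous u)
  · exact intervalIntegrable_comp_rho T
      (continuous_deltaPrimitive_weighted T hab M p.continuous v)
  · exact intervalIntegrable_mul_comp_sigma_rho T p.continuous (continuous_weighted hab M u)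
  · exact intervalIntegrable_mul_comp_sigma_rho T p.continuous (continuous_weighted hab M v)

theorem picard_sub_picard_apply' {a b : ℝ} (T : Set ℝ) (hab : a ≤ b) (M : ℝ) (p r : C(ℝ, ℝ))
    (u : C(Icc a b, ℝ)) (t : Icc a b) :
    picard T hab M p u t - picard T hab M r u t = Real.exp (-(M * (t - a))) *
      deltaPrimitive T a
        (deltaPrimitive T a fun s => (p - r) s * weighted hab M u (sigma T s)) t := by
  have h1 : (fun s => (p - r) s * weighted hab M u (sigma T s)) = fun s =>
      p s * weighted hab M u (sigma T s) - r s * weighted hab M u (sigma T s) := by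
    funext s; rw [ContinuousMap.sub_apply]; ring
  rw [h1, deltaPrimitive_sub, deltaPrimitive_sub]
  · simp only [picard, ContinuousMap.coe_mk]; ring
  · exact intervalIntegrable_comp_rho T
      (continuous_deltaPrimitive_weighted T hab M p.continuous u)
  · exact intervalIntegrable_comp_rho T
      (continuous_deltaPrimitive_weighted T hab M r.continuous u)
  · exact intervalIntegrable_mul_comp_sigma_rho T p.continuous (continuous_weighted hab M u)
  · exact intervalIntegrable_mul_comp_sigma_rho T r.continuous (continuous_weighted hab M u)

theorem abs_weighted_volterra_le {a b C M : ℝ} (hT : IsClosed T) (ha : a ∈ T)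
    (hTab : ∀ s ∈ T, s ∈ Icc a b) (hab : a ≤ b) (hC : 0 ≤ C) (hM : 0 < M) {p : C(ℝ, ℝ)}
    (hp : ∀ s ∈ T, |p s| ≤ C) (u : C(Icc a b, ℝ)) (t : Icc a b) :
    |Real.exp (-(M * (t - a))) * deltaPrimitive T a
        (deltaPrimitive T a fun s => p s * weighted hab M u (sigma T s)) t|
      ≤ C * (b - a) / M * ‖u‖ := by
  have h := abs_deltaPrimitive_deltaPrimitive_le hT ha hTab hC hM (norm_nonneg u) hp
    (fun s _ => abs_weighted_le hab M u s) t.2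
  rw [abs_mul, abs_of_pos (Real.exp_pos _)]
  calc _ ≤ Real.exp (-(M * (t - a))) * (C * (b - a) / M * ‖u‖ * Real.exp (M * (t - a))) := by
        gcongr
    _ = C * (b - a) / M * ‖u‖ * (Real.exp (-(M * (t - a))) * Real.exp (M * (t - a))) := by ring
    _ = _ := by rw [← Real.exp_add, neg_add_cancel, Real.exp_zero, mul_one]

theorem dist_picard_le {a b C M : ℝ} (hT : IsClosed T) (ha : a ∈ T)
    (hTab : ∀ s ∈ T, s ∈ Icc a b) (hab : a ≤ b) (hC : 0 ≤ C) (hM : 0 < M) {p : C(ℝ, ℝ)}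
    (hp : ∀ s ∈ T, |p s| ≤ C) (u v : C(Icc a b, ℝ)) :
    dist (picard T hab M p u) (picard T hab M p v) ≤ C * (b - a) / M * dist u v := by
  have hba : 0 ≤ b - a := by linarith
  rw [ContinuousMap.dist_le (by positivity)]
  intro t
  rw [Real.dist_eq, picard_sub_picard_apply, dist_eq_norm]
  exact abs_weighted_volterra_le hT ha hTab hab hC hM hp _ t

theorem dist_picard_picard_le {a b C M : ℝ} (hT : IsClosed T) (ha : a ∈ T)
    (hTab : ∀ s ∈ T, s ∈ Icc a b) (hab : a ≤ b) (hC : 0 ≤ C) (hM : 0 < M) {p r : C(ℝ, ℝ)}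
    (hpr : ∀ s ∈ T, |(p - r) s| ≤ C) (u : C(Icc a b, ℝ)) :
    dist (picard T hab M p u) (picard T hab M r u) ≤ C * (b - a) / M * ‖u‖ := by
  have hba : 0 ≤ b - a := by linarith
  rw [ContinuousMap.dist_le (by positivity)]
  intro t
  rw [Real.dist_eq, picard_sub_picard_apply']
  exact abs_weighted_volterra_le hT ha hTab hab hC hM hpr _ t

/-- For a nonnegative kernel the operator preserves the closed cone of nonnegative functions, so the
iterates of 0, and hence their limit, stay in it. -/
theorem exists_picard_eq_self {a b C M : ℝ} (hT : IsClosed T) (ha : a ∈ T)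
    (hTab : ∀ s ∈ T, s ∈ Icc a b) (hab : a ≤ b) (hC : 0 ≤ C) (hM : 0 < M)
    (hCM : C * (b - a) / M ≤ 1 / 2) {p : C(ℝ, ℝ)} (hp : ∀ s ∈ T, |p s| ≤ C) :
    ∃ u : C(Icc a b, ℝ), picard T hab M p u = u ∧ ((∀ s ∈ T, 0 ≤ p s) → ∀ t, 0 ≤ u t) := by
  have hcontr : ContractingWith (1 / 2) (picard T hab M p) := by
    refine ⟨by
      rw [← NNReal.coe_lt_coe]; norm_num, LipschitzWith.of_dist_le_mul fun u v => ?_⟩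
    refine (dist_picard_le hT ha hTab hab hC hM hp u v).trans ?_
    refine mul_le_mul_of_nonneg_right ?_ dist_nonneg
    simpa using hCM
  refine ⟨ContractingWith.fixedPoint _ hcontr, hcontr.fixedPoint_isFixedPt, fun hpos => ?_⟩
  have hclosed : IsClosed {u : C(Icc a b, ℝ) | ∀ t, 0 ≤ u t} := by
    simp only [ofPred_forall]
    exact isClosed_iInter fun t => isClosed_le continuous_const (continuous_eval_const t)
  refine hclosed.mem_of_tendsto (hcontr.tendsto_iterate_fixedPoint 0)
    (Eventually.of_forall fun n => ?_)
  induction n with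
  | zero => intro t; simp
  | succ n ih =>
    rw [Function.iterate_succ_apply']
    intro t
    refine mul_nonneg (Real.exp_pos _).le (add_nonneg zero_le_one ?_)
    refine deltaPrimitive_nonneg hT ha hTab (fun r hr => ?_) t.2
    refine deltaPrimitive_nonneg hT ha hTab (fun s hs => ?_) (hTab r hr)
    exact mul_nonneg (hpos s hs) (mul_nonneg (Real.exp_pos _).le (ih _))

/-! ### The initial value problem and its dependence on `l`. -/

/-- `(y, z)` solves `y^Δ = z`, `z^Δ = (Q - l) y^σ` with `y(a) = 1`, `z(a) = 0` on `T`. -/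
structure IsInitialSolution (T : Set ℝ) (a : ℝ) (Q : ℝ → ℝ) (l : ℝ) (y z : ℝ → ℝ) : Prop where
  left : y a = 1
  left' : z a = 0
  cont : Continuous y
  cont' : Continuous z
  deriv : ∀ t ∈ T, HasDeltaDerivAt T y (z t) t
  deriv' : ∀ t ∈ T, HasDeltaDerivAt T z ((Q t - l) * y (sigma T t)) t
  -- Truncating `T` at `c` makes `c` right-dense even if it is right-scattered in `T`. From the left
  -- `σ s → c`, so the one-sided derivative involves `y c`, which has to agree with `y (σ c)`.
  derivWithin' : ∀ c ∈ T, y (sigma T c) = y c →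
    HasDerivWithinAt z ((Q c - l) * y (sigma T c)) (T ∩ Iic c) c

/-- Removing the weight turns the fixed point equation into `y = 1 + ∫∫ (Q - l) y^σ`, which is then
differentiated twice. -/
theorem isInitialSolution_of_picard_eq {a b M l : ℝ} (hT : IsClosed T) (ha : a ∈ T)
    (hTab : ∀ s ∈ T, s ∈ Icc a b) (hab : a ≤ b) (Q : C(ℝ, ℝ)) {u : C(Icc a b, ℝ)}
    (hu : picard T hab M (Q - .const ℝ l) u = u) :
    IsInitialSolution T a Q l (weighted hab M u)
      (deltaPrimitive T a fun s => (Q s - l) * weighted hab M u (sigma T s)) := by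
  set y := weighted hab M u with hy
  set z := deltaPrimitive T a fun s => (Q s - l) * y (sigma T s) with hz
  have hyc : Continuous y := continuous_weighted hab M u
  have hpc : Continuous fun s => Q s - l := by fun_prop
  have hzc : Continuous z := continuous_deltaPrimitive_weighted T hab M hpc u
  have hint := intervalIntegrable_mul_comp_sigma_rho T hpc hyc
  have heq : ∀ t ∈ Icc a b, y t = 1 + deltaPrimitive T a z t := by
    intro t ht
    rw [hy, weighted_of_mem hab M u ht]
    conv_lhs => rw [← hu]
    simp only [picard, ContinuousMap.coe_mk, ContinuousMap.sub_apply, ContinuousMap.const_apply]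
    rw [← mul_assoc, ← Real.exp_add, add_neg_cancel, Real.exp_zero, one_mul]
  refine ⟨?_, ?_, hyc, hzc, ?_, ?_, ?_⟩
  · rw [heq a (hTab a ha)]; simp [deltaPrimitive]
  · simp [hz, deltaPrimitive]
  · intro t ht
    have h1 := hasDeltaDerivAt_integral_comp_rho (a := a) hT
      (intervalIntegrable_comp_rho T hzc) ht fun _ => hzc.continuousWithinAt
    refine HasDeltaDerivAt.congr (f := fun t => 1 + deltaPrimitive T a z t) ?_ hT ht
      fun s hs => heq s (hTab s hs)
    intro ε hε
    obtain ⟨δ, hδ, H⟩ := h1 ε hε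
    refine ⟨δ, hδ, fun s hs hs' => ?_⟩
    convert H s hs hs' using 3
    simp [deltaPrimitive]
  · intro t ht
    refine hasDeltaDerivAt_integral_comp_rho (a := a) (f := fun s => (Q s - l) * y (sigma T s))
      hT hint ht fun h => ?_
    exact hpc.continuousWithinAt.mul
      (hyc.continuousAt.comp_continuousWithinAt (continuousWithinAt_sigma h))
  · intro c hc hyσ
    refine hasDerivWithinAt_integral_comp_rho (a := a) (U := Iic c)
      (f := fun s => (Q s - l) * y (sigma T s)) hT hint ordConnected_Iic ⟨hc, mem_Iic.2 le_rfl⟩ ?_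
    -- `σ` may jump at `c`; its truncation agrees with it to the left of `c` and is continuous
    -- there.
    have h1 : ContinuousWithinAt (fun s => min (sigma T s) c) (T ∩ Iic c) c := by
      have h0 : min (sigma T c) c = c := min_eq_right (le_sigma T c)
      change Tendsto _ _ (𝓝 (min (sigma T c) c))
      rw [h0]
      refine tendsto_of_tendsto_of_tendsto_of_le_of_le' (g := id) (h := fun _ => c)
        continuousWithinAt_id tendsto_const_nhds ?_ ?_
      · filter_upwards [self_mem_nhdsWithin] with s hs
        exact le_min (le_sigma T s) hs.2
      · exact Eventually.of_forall fun s => min_le_right _ _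
    have h2 : ContinuousWithinAt (fun s => (Q s - l) * y (min (sigma T s) c)) (T ∩ Iic c) c :=
      hpc.continuousWithinAt.mul (hyc.continuousAt.comp_continuousWithinAt h1)
    refine h2.congr (fun s hs => ?_) ?_
    · rcases (show s ≤ c from hs.2).eq_or_lt with h | h
      · subst h
        rw [min_eq_right (le_sigma T s), hyσ]
      · rw [min_eq_left (sigma_le hc h)]
    · rw [min_eq_right (le_sigma T c), hyσ]

/-- The initial value problem has solutions depending continuously on the spectral parameter. -/
theorem exists_isInitialSolution_family {a b : ℝ} (hT : IsClosed T) (ha : a ∈ T)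
    (hTab : ∀ s ∈ T, s ∈ Icc a b) (Q : C(ℝ, ℝ)) (l₀ l₁ : ℝ) :
    ∃ y z : ℝ → ℝ → ℝ,
      (∀ l ∈ Icc l₀ l₁, IsInitialSolution T a Q l (y l) (z l)) ∧
      (∀ l ∈ Icc l₀ l₁, (∀ s ∈ T, l ≤ Q s) → ∀ t ∈ T, 0 ≤ y l t) ∧
      ContinuousOn (Function.uncurry y) (Icc l₀ l₁ ×ˢ univ) ∧
      ∀ t ∈ T, ContinuousOn (fun l => z l t) (Icc l₀ l₁) := by
  have hab : a ≤ b := (hTab a ha).2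
  have hba : 0 ≤ b - a := by linarith
  obtain ⟨C₀, hC₀⟩ := isCompact_Icc.exists_bound_of_continuousOn
    (Q.continuous.continuousOn (s := Icc a b))
  set C := |C₀| + |l₀| + |l₁| with hCdef
  have hC : 0 ≤ C := by positivity
  have hbound : ∀ l ∈ Icc l₀ l₁, ∀ s ∈ T, |(Q - .const ℝ l : C(ℝ, ℝ)) s| ≤ C := by
    intro l hl s hs
    have h1 : |Q s| ≤ |C₀| := (hC₀ s (hTab s hs)).trans (le_abs_self _)
    have h2 : |l| ≤ |l₀| + |l₁| := by
      rw [abs_le]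
      constructor
      · linarith [neg_abs_le l₀, abs_nonneg l₁, hl.1]
      · linarith [le_abs_self l₁, abs_nonneg l₀, hl.2]
    simp only [ContinuousMap.sub_apply, ContinuousMap.const_apply]
    linarith [abs_sub (Q s) l]
  -- Chosen for the contraction factor 1/2; the summand 1 keeps `M` positive.
  set M := 2 * (C * (b - a)) + 1 with hMdef
  have hCba : 0 ≤ C * (b - a) := by positivity
  have hM : 0 < M := by linarith
  have hCM : C * (b - a) / M ≤ 1 / 2 := by
    rw [div_le_div_iff₀ hM two_pos]; linarith
  have hex : ∀ l, ∃ u : C(Icc a b, ℝ), l ∈ Icc l₀ l₁ →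
      picard T hab M (Q - .const ℝ l) u = u ∧
      ((∀ s ∈ T, 0 ≤ (Q - .const ℝ l : C(ℝ, ℝ)) s) → ∀ t, 0 ≤ u t) := by
    intro l
    by_cases hl : l ∈ Icc l₀ l₁
    · obtain ⟨u, hu⟩ := exists_picard_eq_self hT ha hTab hab hC hM hCM (hbound l hl)
      exact ⟨u, fun _ => hu⟩
    · exact ⟨0, fun h => absurd h hl⟩
  choose U hU using hex
  have hUcont : ContinuousOn U (Icc l₀ l₁) := by
    intro k hk
    -- Compare both fixed points with the `l`-operator applied to `U k`: contraction absorbs half of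
    -- the distance, and the rest is linear in `|k - l|`.
    have hest : ∀ l ∈ Icc l₀ l₁,
        dist (U l) (U k) ≤ 2 * (|k - l| * (b - a) / M * ‖U k‖) := by
      intro l hl
      have h1 := dist_picard_le hT ha hTab hab hC hM (hbound l hl) (U l) (U k)
      have h2 := dist_picard_picard_le hT ha hTab hab (abs_nonneg (k - l)) hM
        (p := Q - .const ℝ l) (r := Q - .const ℝ k) (fun s _ => by
          simp) (U k)
      rw [(hU l hl).1] at h1
      rw [(hU k hk).1] at h2
      have h3 := dist_triangle (U l) (picard T hab M (Q - .const ℝ l) (U k)) (U k)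
      have h4 : C * (b - a) / M * dist (U l) (U k) ≤ 1 / 2 * dist (U l) (U k) := by gcongr
      linarith
    refine tendsto_iff_dist_tendsto_zero.2 ?_
    refine squeeze_zero' (Eventually.of_forall fun _ => dist_nonneg)
      (eventually_nhdsWithin_of_forall hest) ?_
    have : Continuous fun l => 2 * (|k - l| * (b - a) / M * ‖U k‖) := by fun_prop
    have h0 := this.tendsto k
    simp only [sub_self, abs_zero, zero_mul, zero_div, mul_zero] at h0
    exact h0.mono_left nhdsWithin_le_nhds
  have hjoint : ContinuousOn (Function.uncurry fun l => weighted hab M (U l))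
      (Icc l₀ l₁ ×ˢ univ) := by
    have h1 : ContinuousOn (fun x : ℝ × ℝ => (U x.1, projIcc a b hab x.2)) (Icc l₀ l₁ ×ˢ univ) :=
      (hUcont.comp continuousOn_fst fun x hx => hx.1).prodMk
        (continuous_projIcc.comp continuous_snd).continuousOn
    have h2 := continuous_eval.comp_continuousOn h1
    have h3 : Continuous fun x : ℝ × ℝ => Real.exp (M * (x.2 - a)) := by fun_prop
    exact h3.continuousOn.mul h2
  refine ⟨fun l => weighted hab M (U l),
    fun l => deltaPrimitive T a fun s => (Q s - l) * weighted hab M (U l) (sigma T s),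
    fun l hl => isInitialSolution_of_picard_eq hT ha hTab hab Q (hU l hl).1,
    fun l hl hpos t ht => ?_, hjoint, fun t ht => ?_⟩
  · change 0 ≤ weighted hab M (U l) t
    rw [weighted_of_mem hab M _ (hTab t ht)]
    refine mul_nonneg (Real.exp_pos _).le ((hU l hl).2 (fun s hs => ?_) _)
    simpa using hpos s hs
  · obtain ⟨B, hB⟩ := (isCompact_Icc.prod isCompact_Icc).exists_bound_of_continuousOn
      (hjoint.mono (prod_mono_right (subset_univ (Icc a b))))
    intro k hk
    refine intervalIntegral.continuousWithinAt_of_dominated_interval (bound := fun _ => C * B)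
      ?_ ?_ (by simp) ?_
    · refine eventually_nhdsWithin_of_forall fun l _ => ?_
      exact (intervalIntegrable_mul_comp_sigma_rho T (g := fun s => Q s - l) (by fun_prop)
        (continuous_weighted hab M (U l)) a t).def'.aestronglyMeasurable
    · refine eventually_nhdsWithin_of_forall fun l hl => Eventually.of_forall fun x hx => ?_
      rw [uIoc_of_le (hTab t ht).1] at hx
      have hmem := rho_mem hT ha hx.1
      rw [norm_mul]
      refine mul_le_mul ?_ (hB (l, _) ⟨hl, hTab _ (sigma_mem hT hmem)⟩) (norm_nonneg _) hC
      simpa using hbound l hl _ hmem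
    · refine Eventually.of_forall fun x _ => ?_
      have h1 : ContinuousWithinAt (fun l => weighted hab M (U l) (sigma T (rho T x)))
          (Icc l₀ l₁) k :=
        (hjoint (k, sigma T (rho T x)) ⟨hk, mem_univ _⟩).comp (f := fun l => (l, _))
          (by fun_prop) fun l hl => ⟨hl, mem_univ _⟩
      exact ContinuousWithinAt.mul (by fun_prop) h1

/-! ### From zeros of `z(ρ(b))` to eigenvalues. -/

theorem kappa_eq {b : ℝ} (hb : IsGreatest T b) : kappa T = T ∩ Iic (rho T b) := by
  ext t
  simp only [kappa, mem_ofPred_eq, mem_inter_iff, mem_Iic]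
  refine and_congr_right fun ht => ?_
  constructor
  · intro h
    rcases (hb.2 ht).eq_or_lt with h' | h'
    · subst h'
      exact not_lt.1 fun hlt => h ⟨hb, hlt⟩
    · exact le_rho ht h'
  · rintro h ⟨hg, hlt⟩
    rw [hg.unique hb] at h hlt
    exact absurd h (not_le.2 hlt)

theorem sigma_inter_Iic {c : ℝ} (hc : c ∈ T) (htc : t < c) :
    sigma (T ∩ Iic c) t = sigma T t := by
  apply le_antisymm
  · conv_rhs => unfold sigma
    rw [if_pos ⟨c, hc, htc⟩]
    refine le_csInf ⟨c, hc, htc⟩ fun s hs => ?_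
    rcases le_or_gt s c with h | h
    · exact sigma_le ⟨hs.1, h⟩ hs.2
    · exact (sigma_le (T := T ∩ Iic c) ⟨hc, mem_Iic.2 le_rfl⟩ htc).trans h.le
  · conv_rhs => unfold sigma
    rw [if_pos ⟨c, ⟨hc, mem_Iic.2 le_rfl⟩, htc⟩]
    exact le_csInf ⟨c, ⟨hc, mem_Iic.2 le_rfl⟩, htc⟩ fun s hs => sigma_le hs.1.1 hs.2

theorem sigma_inter_Iic_self (T : Set ℝ) (c : ℝ) : sigma (T ∩ Iic c) c = c := by
  unfold sigma
  rw [if_neg]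
  rintro ⟨s, hs, h⟩
  exact absurd hs.2 (not_le.2 h)

theorem IsInitialSolution.isNeumannEigenvalue {a b l : ℝ} {Q q y z : ℝ → ℝ}
    (ha : IsLeast T a) (hb : IsGreatest T b) (hc : rho T b ∈ T)
    (h : IsInitialSolution T a Q l y z) (hQ : EqOn Q q T) (hz : z (rho T b) = 0) :
    IsNeumannEigenvalue T q l := by
  have hsub : kappa (kappa T) ⊆ T := fun s hs => hs.1.1
  refine ⟨y, z, fun t => (Q t - l) * y (sigma T t), ⟨a, ha.1, by simp [h.left]⟩,
    fun t ht => h.deriv t ht.1, fun t ht => ?_, fun t ht => ?_, ?_, ?_⟩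
  · have htS := ht.1
    rw [kappa_eq hb] at htS ⊢
    rcases (show t ≤ rho T b from htS.2).eq_or_lt with htc | htc
    · rw [htc, hasDeltaDerivAt_iff_of_sigma_eq (sigma_inter_Iic_self T _)]
      refine h.derivWithin' _ hc ?_
      -- The boundary condition `z(c) = 0` is what gives `y (σ c) = y c`.
      have := (h.deriv _ hc).sigma_sub hc
      rw [hz, zero_mul] at this
      linarith
    · intro ε hε
      obtain ⟨δ, hδ, H⟩ := h.deriv' t htS.1 ε hε
      refine ⟨δ, hδ, fun s hs hs' => ?_⟩
      rw [sigma_inter_Iic hc htc]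
      exact H s hs.1 hs'
  · simp only [hQ (hsub ht)]; ring
  · rw [ha.csInf_eq]; exact h.left'
  · rw [hb.csSup_eq]; exact hz

/-! ### Comparison of solutions and the limit of very negative `l`. -/

/-- A nonnegative solution has negative derivative at its zeros. -/
theorem IsInitialSolution.neg_of_eq_zero {a l l₀ : ℝ} {Q y z y₀ z₀ : ℝ → ℝ}
    (hT : IsClosed T) (ha : a ∈ T) (h : IsInitialSolution T a Q l y z)
    (h₀ : IsInitialSolution T a Q l₀ y₀ z₀) (hl : l₀ < l) (ht : t ∈ T) (hat : a < t)
    (hy : ∀ s ∈ T, s ∈ Icc a t → 0 ≤ y s) (hy₀ : ∀ s ∈ T, s ∈ Icc a t → 0 < y₀ s)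
    (hyt : y t = 0) : z t < 0 := by
  -- The Wronskian: the terms with `Q` cancel, leaving `V^Δ = (l - l₀) y₀^σ y^σ`.
  set V : ℝ → ℝ := fun s => y s * z₀ s - y₀ s * z s with hV
  have hVd : ∀ s ∈ T, HasDeltaDerivAt T V ((l - l₀) * (y₀ (sigma T s) * y (sigma T s))) s := by
    intro s hs
    have := ((h.deriv s hs).mul (h₀.deriv' s hs) hs).sub
      ((h₀.deriv s hs).mul (h.deriv' s hs) hs) hs
    convert this using 1
    ring
  have hσ : ∀ s ∈ T, s ∈ Ico a t → sigma T s ∈ T ∧ sigma T s ∈ Icc a t := fun s hs hst =>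
    ⟨sigma_mem hT hs, hst.1.trans (le_sigma T s), sigma_le ht hst.2⟩
  -- Makes `V^Δ(a)` strictly positive even when `a` is right-scattered, so `V` leaves zero at once.
  have hya : y (sigma T a) = 1 := by
    have := (h.deriv a ha).sigma_sub ha
    rw [h.left, h.left', zero_mul] at this
    linarith
  have hd0 : 0 < (l - l₀) * (y₀ (sigma T a) * y (sigma T a)) := by
    obtain ⟨h1, h2⟩ := hσ a ha ⟨le_rfl, hat⟩
    have := hy₀ _ h1 h2
    rw [hya, mul_one]
    exact mul_pos (sub_pos.2 hl) this
  obtain ⟨s, hs, hst, hVs⟩ := (hVd a ha).exists_add_le hT ha ht hat (half_lt_self hd0)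
  have hVa : V a = 0 := by simp [hV, h.left', h₀.left']
  have hVpos : 0 < V s := by
    rw [hVa] at hVs
    have := mul_pos (half_pos hd0) (sub_pos.2 hst.1)
    linarith
  have hVt : V s ≤ V t := by
    refine le_of_hasDeltaDerivAt_nonneg hT hs ht hst.2 ?_
      (fun r hr _ => hVd r hr) (fun r hr hrt => ?_)
    · exact ((h.cont.mul h₀.cont').sub (h₀.cont.mul h.cont')).continuousOn
    · obtain ⟨h1, h2⟩ := hσ r hr ⟨hst.1.le.trans hrt.1, hrt.2⟩
      exact mul_nonneg (sub_nonneg.2 hl.le) (mul_nonneg (hy₀ _ h1 h2).le (hy _ h1 h2))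
  have hVt' : V t = -(y₀ t * z t) := by simp [hV, hyt]
  have := hy₀ t ht ⟨hat.le, le_rfl⟩
  by_contra! hz
  nlinarith [mul_nonneg this.le hz]

theorem IsInitialSolution.one_le {a l : ℝ} {Q y z : ℝ → ℝ} (hT : IsClosed T) (ha : IsLeast T a)
    (h : IsInitialSolution T a Q l y z) (hl : ∀ s ∈ T, l ≤ Q s) (hy : ∀ s ∈ T, 0 ≤ y s)
    (ht : t ∈ T) : 1 ≤ y t := by
  have hz : ∀ s ∈ T, 0 ≤ z s := by
    intro s hs
    rw [← h.left']
    exact le_of_hasDeltaDerivAt_nonneg hT ha.1 hs (ha.2 hs) h.cont'.continuousOn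
      (fun r hr _ => h.deriv' r hr)
      fun r hr _ => mul_nonneg (sub_nonneg.2 (hl r hr)) (hy _ (sigma_mem hT hr))
  rw [← h.left]
  exact le_of_hasDeltaDerivAt_nonneg hT ha.1 ht (ha.2 ht) h.cont.continuousOn
    (fun r hr _ => h.deriv r hr) fun r hr _ => hz r hr

/-- Here `z^Δ = (Q - l) y^σ ≥ 1`. This gives `z(c) > 0` at the starting parameter. -/
theorem IsInitialSolution.sub_le {a l : ℝ} {Q y z : ℝ → ℝ} (hT : IsClosed T) (ha : IsLeast T a)
    (h : IsInitialSolution T a Q l y z) (hl : ∀ s ∈ T, l + 1 ≤ Q s) (hy : ∀ s ∈ T, 1 ≤ y s)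
    (ht : t ∈ T) : t - a ≤ z t := by
  have hmono : z a - 1 * a ≤ z t - 1 * t := by
    refine le_of_hasDeltaDerivAt_nonneg (f := fun s => z s - 1 * s) hT ha.1 ht (ha.2 ht)
      (h.cont'.sub (by fun_prop)).continuousOn
      (fun r hr _ => (h.deriv' r hr).sub (hasDeltaDerivAt_const_mul_id T 1 r) hr)
      fun r hr _ => ?_
    have h1 := hl r hr
    have h2 := hy _ (sigma_mem hT hr)
    nlinarith
  rw [h.left'] at hmono
  linarith

/-! ### The Riccati argument. -/

/-- If the solution is positive and `l` is the mean value of `Q`, the Riccati equation for `z / y`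
forces `Q = l`. -/
theorem IsInitialSolution.eq_of_mean {a c l : ℝ} {Q F y z : ℝ → ℝ} (hT : IsClosed T)
    (ha : a ∈ T) (hc : c ∈ T) (hac : a ≤ c) (h : IsInitialSolution T a Q l y z)
    (hy : ∀ s ∈ T, s ∈ Icc a c → 0 < y s) (hz : 0 ≤ z c)
    (hF : ∀ s ∈ T, s ∈ Icc a c → HasDeltaDerivAt T F (Q s) s)
    (hmean : F c - F a = l * (c - a)) (ht : t ∈ T) (htc : t ∈ Ico a c) : Q t = l := by
  have hσ : ∀ s ∈ T, s ∈ Ico a c → sigma T s ∈ T ∧ sigma T s ∈ Icc a c := fun s hs hsc =>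
    ⟨sigma_mem hT hs, hsc.1.trans (le_sigma T s), sigma_le hc hsc.2⟩
  have hyσ : ∀ s ∈ T, s ∈ Ico a c → 0 < y (sigma T s) := fun s hs hsc =>
    hy _ (hσ s hs hsc).1 (hσ s hs hsc).2
  set G : ℝ → ℝ := fun s => (F s - l * s) - z s / y s with hG
  have hGd : ∀ s ∈ T, s ∈ Ico a c →
      HasDeltaDerivAt T G (z s ^ 2 / (y s * y (sigma T s))) s := by
    intro s hs hsc
    have h1 := (hy s hs ⟨hsc.1, hsc.2.le⟩).ne'
    have h2 := (hyσ s hs hsc).ne'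
    have := ((hF s hs ⟨hsc.1, hsc.2.le⟩).sub (hasDeltaDerivAt_const_mul_id T l s) hs).sub
      ((h.deriv' s hs).div (h.deriv s hs) hs h1 h2) hs
    convert this using 1
    field_simp
    ring
  have hGc : ContinuousOn G (T ∩ Icc a c) := by
    refine ContinuousOn.sub (ContinuousOn.sub (fun s hs => ?_) (by fun_prop))
      (h.cont'.continuousOn.div h.cont.continuousOn fun s hs => (hy s hs.1 hs.2).ne')
    exact ((hF s hs.1 hs.2).continuousWithinAt hs.1).mono inter_subset_left
  have hGnonneg : ∀ s ∈ T, s ∈ Ico a c → 0 ≤ z s ^ 2 / (y s * y (sigma T s)) := fun s hs hsc =>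
    div_nonneg (sq_nonneg _) (mul_pos (hy s hs ⟨hsc.1, hsc.2.le⟩) (hyσ s hs hsc)).le
  have hGmono : ∀ r ∈ T, ∀ s ∈ T, a ≤ r → r ≤ s → s ≤ c → G r ≤ G s := by
    intro r hr s hs har hrs hsc
    exact le_of_hasDeltaDerivAt_nonneg hT hr hs hrs
      (hGc.mono fun x hx => ⟨hx.1, har.trans hx.2.1, hx.2.2.trans hsc⟩)
      (fun x hx hx' => hGd x hx ⟨har.trans hx'.1, hx'.2.trans_le hsc⟩)
      (fun x hx hx' => hGnonneg x hx ⟨har.trans hx'.1, hx'.2.trans_le hsc⟩)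
  have hGa : G a = F a - l * a := by simp [hG, h.left']
  have hycpos := hy c hc ⟨hac, le_rfl⟩
  -- By the mean value hypothesis the part `F s - l * s` has equal values at `a` and `c`.
  have hGca : G c = G a - z c / y c := by
    rw [hGa]; simp only [hG]; linarith
  have hzc : z c = 0 := by
    have h1 := hGmono a ha c hc le_rfl hac le_rfl
    have h2 : z c / y c ≤ 0 := by linarith
    have h3 : 0 ≤ z c / y c := div_nonneg hz hycpos.le
    rcases div_eq_zero_iff.1 (le_antisymm h2 h3) with h4 | h4
    · exact h4
    · exact absurd h4 hycpos.ne'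
  have hz0 : ∀ s ∈ T, s ∈ Icc a c → z s = 0 := by
    intro s hs hsc
    rcases hsc.2.eq_or_lt with h' | h'
    · rw [h', hzc]
    · by_contra hne
      -- A nonzero `z s` would make `G` grow strictly, although it is monotone with `G a = G c`.
      have hpos : 0 < z s ^ 2 / (y s * y (sigma T s)) :=
        div_pos (by positivity) (mul_pos (hy s hs hsc) (hyσ s hs ⟨hsc.1, h'⟩))
      obtain ⟨r, hr, hrs, hGr⟩ := (hGd s hs ⟨hsc.1, h'⟩).exists_add_le hT hs hc h'
        (half_lt_self hpos)
      have h1 := hGmono a ha s hs le_rfl hsc.1 hsc.2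
      have h2 := hGmono r hr c hc (hsc.1.trans hrs.1.le) hrs.2 le_rfl
      rw [hzc, zero_div, sub_zero] at hGca
      have := mul_pos (half_pos hpos) (sub_pos.2 hrs.1)
      linarith
  have hzd := h.deriv' t ht
  have hzt := hz0 t ht ⟨htc.1, htc.2.le⟩
  have hD : (Q t - l) * y (sigma T t) = 0 := by
    rcases lt_trichotomy ((Q t - l) * y (sigma T t)) 0 with hneg | h0 | hpos
    · obtain ⟨r, hr, hrt, hzr⟩ := hzd.neg.exists_add_le hT ht hc htc.2
        (half_lt_self (neg_pos.2 hneg))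
      rw [hzt, hz0 r hr ⟨htc.1.trans hrt.1.le, hrt.2⟩] at hzr
      have := mul_pos (half_pos (neg_pos.2 hneg)) (sub_pos.2 hrt.1)
      linarith
    · exact h0
    · obtain ⟨r, hr, hrt, hzr⟩ := hzd.exists_add_le hT ht hc htc.2 (half_lt_self hpos)
      rw [hzt, hz0 r hr ⟨htc.1.trans hrt.1.le, hrt.2⟩] at hzr
      have := mul_pos (half_pos hpos) (sub_pos.2 hrt.1)
      linarith
  rcases mul_eq_zero.1 hD with h1 | h1
  · linarith
  · exact absurd h1 (hyσ t ht htc).ne'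

/-! ### Continuation in the spectral parameter. -/

/-- If the problem has no eigenvalue below `lam`, then the solution at `lam` is positive and has
nonnegative derivative at the right end point. -/
theorem exists_pos_isInitialSolution {a b lam : ℝ} {q : ℝ → ℝ} (hT : IsClosed T)
    (ha : IsLeast T a) (hb : IsGreatest T b) (hc : rho T b ∈ T) (hac : a < rho T b) (Q : C(ℝ, ℝ))
    (hQ : EqOn Q q T) (hlam : ∀ l, IsNeumannEigenvalue T q l → lam ≤ l) :
    ∃ y z : ℝ → ℝ, IsInitialSolution T a Q lam y z ∧
      (∀ s ∈ T, s ∈ Icc a (rho T b) → 0 < y s) ∧ 0 ≤ z (rho T b) := by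
  set c := rho T b with hcdef
  have hTab : ∀ s ∈ T, s ∈ Icc a b := fun s hs => ⟨ha.2 hs, hb.2 hs⟩
  obtain ⟨C, hC⟩ := isCompact_Icc.exists_bound_of_continuousOn
    (Q.continuous.continuousOn (s := Icc a b))
  -- The first bound gives `l₀ < lam`, the second `l₀ + 1 ≤ -C ≤ Q` on `T`.
  set l₀ := min (lam - 1) (-C - 1) with hl₀
  have hl₀lam : l₀ < lam := (min_le_left _ _).trans_lt (by linarith)
  have hl₀Q : ∀ s ∈ T, l₀ + 1 ≤ Q s := by
    intro s hs
    have h1 := (abs_le.1 (hC s (hTab s hs))).1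
    have h2 : l₀ ≤ -C - 1 := min_le_right _ _
    linarith
  obtain ⟨y, z, hsol, hnn, hycont, hzcont⟩ :=
    exists_isInitialSolution_family hT ha.1 hTab Q l₀ lam
  have hmem₀ : l₀ ∈ Icc l₀ lam := ⟨le_rfl, hl₀lam.le⟩
  have hl₀Q' : ∀ s ∈ T, l₀ ≤ Q s := fun s hs => by linarith [hl₀Q s hs]
  have hy₀ : ∀ s ∈ T, 1 ≤ y l₀ s := fun s hs =>
    (hsol l₀ hmem₀).one_le hT ha hl₀Q' (hnn l₀ hmem₀ hl₀Q') hs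
  have hz₀ : 0 < z l₀ c := by
    have := (hsol l₀ hmem₀).sub_le hT ha hl₀Q hy₀ hc
    linarith
  have hzc : ∀ l ∈ Icc l₀ lam, 0 ≤ z l c := by
    intro l hl
    by_contra! hneg
    -- The zero `k ≤ l` is an eigenvalue, so `k ≥ lam ≥ l` and `k = l`, where the value is negative.
    obtain ⟨k, hk, hzk⟩ := intermediate_value_Icc' hl.1
      ((hzcont c hc).mono (Icc_subset_Icc_right hl.2)) ⟨hneg.le, hz₀.le⟩
    have hk' : k ∈ Icc l₀ lam := ⟨hk.1, hk.2.trans hl.2⟩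
    have h1 := hlam k ((hsol k hk').isNeumannEigenvalue ha hb hc hQ hzk)
    have h2 : k = l := le_antisymm hk.2 (hl.2.trans h1)
    rw [h2] at hzk
    exact hneg.ne hzk
  set K := T ∩ Icc a c with hK
  have hKc : IsCompact K := isCompact_Icc.inter_left hT
  have hKne : K.Nonempty := ⟨a, ha.1, le_rfl, hac.le⟩
  have hgcont : ContinuousOn (fun l => sInf (y l '' K)) (Icc l₀ lam) := by
    rw [continuousOn_iff_continuous_domRestrict]
    refine hKc.continuous_sInf (f := fun (l : Icc l₀ lam) t => y l t) ?_
    exact hycont.comp_continuous (f := fun x : Icc l₀ lam × ℝ => ((x.1 : ℝ), x.2))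
      (by fun_prop) fun x => ⟨x.1.2, mem_univ _⟩
  have hmin : ∀ l ∈ Icc l₀ lam, ∃ t ∈ K, sInf (y l '' K) = y l t ∧ ∀ s ∈ K, y l t ≤ y l s :=
    fun l hl => hKc.exists_sInf_image_eq_and_le hKne (hsol l hl).cont.continuousOn
  have hne : ∀ l ∈ Icc l₀ lam, sInf (y l '' K) ≠ 0 := by
    intro l hl h0
    obtain ⟨t, ht, hinf, hle⟩ := hmin l hl
    rw [h0] at hinf
    have hyn : ∀ s ∈ T, s ∈ Icc a c → 0 ≤ y l s := fun s hs hsc => by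
      rw [hinf]; exact hle s ⟨hs, hsc⟩
    have hat : a < t := by
      rcases ht.2.1.eq_or_lt with h' | h'
      · rw [← h', (hsol l hl).left] at hinf
        exact absurd hinf zero_ne_one
      · exact h'
    have hll : l₀ < l := by
      rcases hl.1.eq_or_lt with h' | h'
      · rw [← h'] at hinf
        have := hy₀ t ht.1
        linarith
      · exact h'
    have hzt := (hsol l hl).neg_of_eq_zero hT ha.1 (hsol l₀ hmem₀) hll ht.1 hat
      (fun s hs hst => hyn s hs ⟨hst.1, hst.2.trans ht.2.2⟩)
      (fun s hs _ => zero_lt_one.trans_le (hy₀ s hs)) hinf.symm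
    rcases ht.2.2.eq_or_lt with h' | h'
    · rw [h'] at hzt
      exact absurd (hzc l hl) (not_le.2 hzt)
    · obtain ⟨r, hr, hrt, hyr⟩ := ((hsol l hl).deriv t ht.1).neg.exists_add_le hT ht.1 hc h'
        (half_lt_self (neg_pos.2 hzt))
      have h1 := hyn r hr ⟨hat.le.trans hrt.1.le, hrt.2⟩
      have := mul_pos (half_pos (neg_pos.2 hzt)) (sub_pos.2 hrt.1)
      linarith
  have hmem₁ : lam ∈ Icc l₀ lam := ⟨hl₀lam.le, le_rfl⟩
  have hpos : 0 < sInf (y lam '' K) := by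
    by_contra! hle
    have h₀ : 0 ≤ sInf (y l₀ '' K) := by
      obtain ⟨t, ht, hinf, -⟩ := hmin l₀ hmem₀
      rw [hinf]
      exact zero_le_one.trans (hy₀ t ht.1)
    obtain ⟨k, hk, hk0⟩ := intermediate_value_Icc' hl₀lam.le hgcont ⟨hle, h₀⟩
    exact hne k hk hk0
  refine ⟨y lam, z lam, hsol lam hmem₁, fun s hs hsc => ?_, hzc lam hmem₁⟩
  obtain ⟨t, ht, hinf, hle⟩ := hmin lam hmem₁
  rw [hinf] at hpos
  exact hpos.trans_le (hle s ⟨hs, hsc⟩)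

/-! ### Conclusion. -/

/-- Exposes the antiderivative selected by choice in `deltaIntegral`; the Riccati argument works
with any antiderivative, so uniqueness is never needed. -/
theorem exists_deltaIntegral_eq {a b : ℝ} {q : ℝ → ℝ} (hT : IsClosed T) (Q : C(ℝ, ℝ))
    (hQ : EqOn Q q T) :
    ∃ F : ℝ → ℝ, IsAntiderivative T F q ∧ deltaIntegral T q a b = F b - F a := by
  have hex : ∃ F : ℝ → ℝ, IsAntiderivative T F q := by
    refine ⟨deltaPrimitive T a Q, fun t ht => ?_⟩
    rw [← hQ ht.1]
    exact hasDeltaDerivAt_integral_comp_rho hT (intervalIntegrable_comp_rho T Q.continuous) ht.1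
      fun _ => Q.continuous.continuousWithinAt
  refine ⟨hex.choose, hex.choose_spec, ?_⟩
  rw [deltaIntegral, dif_pos hex]

end TimeScale

open TimeScale in
theorem corollary1 (T : Set ℝ) (hT_closed : IsClosed T) (hT_bounded : Bornology.IsBounded T)
    (hT_nonempty : T.Nonempty) (hab : sInf T ≠ TimeScale.rho T (sSup T))
    (q : ℝ → ℝ) (hq : ContinuousOn q T) (lam : ℝ)
    (hlam_first : IsLeast {l : ℝ | TimeScale.IsNeumannEigenvalue T q l} lam)
    (hlam_mean : lam = 1 / (TimeScale.rho T (sSup T) - sInf T) *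
      TimeScale.deltaIntegral T q (sInf T) (TimeScale.rho T (sSup T))) :
    ∀ t ∈ TimeScale.kappa (TimeScale.kappa T), q t = lam := by
  have hcomp : IsCompact T := Metric.isCompact_of_isClosed_isBounded hT_closed hT_bounded
  have ha : IsLeast T (sInf T) := hcomp.isLeast_sInf hT_nonempty
  have hb : IsGreatest T (sSup T) := hcomp.isGreatest_sSup hT_nonempty
  have hTab : ∀ s ∈ T, s ∈ Set.Icc (sInf T) (sSup T) := fun s hs => ⟨ha.2 hs, hb.2 hs⟩
  set a := sInf T
  set b := sSup T
  have hc : rho T b ∈ T := rho_mem_of_mem_Icc hT_closed ha.1 hTab (hTab b hb.1)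
  have hac : a < rho T b := lt_of_le_of_ne (ha.2 hc) hab
  -- Tietze extension: the Lebesgue integrals need a potential continuous on all of `ℝ`.
  obtain ⟨Q, hQr⟩ := ContinuousMap.exists_restrict_eq hT_closed
    (⟨T.domRestrict q, hq.domRestrict⟩ : C(T, ℝ))
  have hQ : Set.EqOn Q q T := fun s hs => DFunLike.congr_fun hQr ⟨s, hs⟩
  obtain ⟨F, hF, hint⟩ := exists_deltaIntegral_eq (a := a) (b := rho T b) hT_closed Q hQ
  have hmean : F (rho T b) - F a = lam * (rho T b - a) := by
    rw [hlam_mean, hint]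
    have : rho T b - a ≠ 0 := (sub_pos.2 hac).ne'
    field_simp
  obtain ⟨y, z, hsol, hy, hz⟩ := exists_pos_isInitialSolution hT_closed ha hb hc hac Q hQ
    fun l hl => hlam_first.2 hl
  have hkappa := kappa_eq hb
  have hlt : ∀ s ∈ T, s ∈ Set.Ico a (rho T b) → q s = lam := by
    intro s hs hsc
    rw [← hQ hs]
    refine hsol.eq_of_mean hT_closed ha.1 hc hac.le hy hz (fun r hr hrc => ?_) hmean hs hsc
    rw [hQ hr]
    exact hF r (hkappa ▸ ⟨hr, hrc.2⟩)
  intro t ht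
  have htS := ht.1
  rw [hkappa] at htS
  rcases (show t ≤ rho T b from htS.2).eq_or_lt with h' | h'
  -- Here `t = ρ(b)` is the maximum of `T^k` and survives in `T^{k²}`, so it is left-dense in `T^k`
  -- and a limit of points where the equality is already known.
  · have hgreat : IsGreatest (kappa T) t := ⟨ht.1, fun s hs => by
      rw [hkappa] at hs; exact h' ▸ hs.2⟩
    have hρ : t ≤ rho (kappa T) t := not_lt.1 fun h => ht.2 ⟨hgreat, h⟩
    have haS : a ∈ kappa T := hkappa ▸ ⟨ha.1, hac.le⟩
    have hcl : t ∈ closure (T ∩ Set.Ico a t) := by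
      rw [Metric.mem_closure_iff]
      intro ε hε
      by_contra! hcon
      have hρ' : rho (kappa T) t ≤ max a (t - ε) := by
        unfold rho
        rw [if_pos ⟨a, haS, h' ▸ hac⟩]
        refine csSup_le ⟨a, haS, h' ▸ hac⟩ fun s hs => ?_
        have := hcon s ⟨hs.1.1, ha.2 hs.1.1, hs.2⟩
        rw [Real.dist_eq, abs_of_pos (sub_pos.2 hs.2)] at this
        exact le_max_of_le_right (by linarith)
      have : max a (t - ε) < t := max_lt (h' ▸ hac) (by linarith)
      linarith
    have hclosed : IsClosed {s | Q s = lam} := isClosed_eq Q.continuous continuous_const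
    have hsub : T ∩ Set.Ico a t ⊆ {s | Q s = lam} := fun s hs => by
      rw [Set.mem_ofPred_eq, hQ hs.1]
      exact hlt s hs.1 (h' ▸ hs.2)
    rw [← hQ htS.1]
    exact hclosed.closure_subset_iff.2 hsub hcl
  · exact hlt t htS.1 ⟨ha.2 htS.1, h'⟩
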